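/- Let $I$ and $J$ be arbitrary index sets, and let $(E_j)_{j\in J}$, $(K_j)_{j\in J}$, $(F_i)_{i\in I}$, $(L_i)_{i\in I}$ be families of complex Hilbert spaces. Write $\mathrm{Mat}(E_j,F_i)$ for the set of all $I\times J$ matrices $X=(X_{ij})$ with $X_{ij}\in B(E_j,F_i)$. For $X\in \mathrm{Mat}(E_j,F_i)$ and $Y\in\mathrm{Mat}(K_j,L_i)$ let $$X\boxtimes Y:=(X_{ij}\otimes Y_{ij})_{ij},\qquad X_{ij}\otimes Y_{ij}\in B(E_j\otimes K_j,\,F_i\otimes L_i),$$ where $\otimes$ is the Hilbert space tensor product; the same notation is used for square matrices, indexed by $I\times I$ or $J\times J$. A matrix $X$ is called row bounded if its rows $(X_{ij})_{j}$, $i\in I$, are the matrices of bounded operators $\bigoplus_{j}E_j\to F_i$ with uniformly bounded norms, and column bounded if its columns $(X_{ij})_{i}$, $j\in J$, are the matrices of bounded operators $E_j\to\bigoplus_i F_i$ with uniformly bounded norms (Hilbert space direct sums). Products of block matrices are formed by $(XY)_{ik}=\sum_j X_{ij}Y_{jk}$ with sums in the strong operator topology. Moreover $(X^*)_{ji}=(X_{ij})^*$;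 $\mathrm{diag}(Z)^{1/2}$ is the diagonal matrix with the entries $(Z_{ii})^{1/2}$; and $I_L$, $I_E$ are the diagonal matrices with the identity operators of the $L_i$, respectively of the $E_j$, on the diagonal. Let $A=(A_{ij})\in\mathrm{Mat}(E_j,F_i)$ be row bounded and let $B=(B_{ij})\in\mathrm{Mat}(K_j,L_i)$ be column bounded. Then: (i) There exist matrices $V=(V_{ij})\in \mathrm{Mat}(E_j,F_i)$ and $W=(W_{ij})\in\mathrm{Mat}(K_j,L_i)$ such that each row of $V$ is the matrix of a partial isometry $\bigoplus_j E_j\to F_i$, each column of $W$ is the matrix of a partial isometry $K_j\to\bigoplus_i L_i$, and $$A\boxtimes B=\big(\mathrm{diag}(AA^*)^{1/2}\boxtimes I_L\big)\,(V\boxtimes W)\,\big(I_E\boxtimes \mathrm{diag}(B^*B)^{1/2}\big).$$ (ii) The matrices $\mathrm{diag}(AA^*)^{1/2}\boxtimes I_L$ and $I_E\boxtimes \mathrm{diag}(B^*B)^{1/2}$ are matrices of bounded operators on $\bigoplus_i F_i\otimes L_i$ and $\bigoplus_j E_j\otimes K_j$, and there exists a matrix $S=(S_{ij})$ with $S_{ij}\in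 B(E_j\otimes K_j,\,F_i\otimes L_i)$, which is the matrix of a contraction $\bigoplus_j E_j\otimes K_j\to\bigoplus_i F_i\otimes L_i$, such that $$A\boxtimes B=\big(\mathrm{diag}(AA^*)^{1/2}\boxtimes I_L\big)\,S\,\big(I_E\boxtimes \mathrm{diag}(B^*B)^{1/2}\big).$$ -/

import Mathlib

open scoped TensorProduct

noncomputable section

namespace BlockSchur

/-! ### Hilbert space tensor products -/

/-- The Hilbert space tensor product: the completion of the algebraic tensor product, equipped
with the inner product determined by `⟪x ⊗ y, x' ⊗ y'⟫ = ⟪x, x'⟫ * ⟪y, y'⟫`. -/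
abbrev HTensor (X Y : Type*) [NormedAddCommGroup X] [InnerProductSpace ℂ X]
    [NormedAddCommGroup Y] [InnerProductSpace ℂ Y] : Type _ :=
  UniformSpace.Completion (X ⊗[ℂ] Y)

/-- The (spatial) tensor product `S ⊗ T` of bounded operators: the unique bounded operator
between the Hilbert space tensor products that maps `x ⊗ y` to `S x ⊗ T y`. -/
def tensorOp {X X' Y Y' : Type*} [NormedAddCommGroup X] [InnerProductSpace ℂ X]
    [NormedAddCommGroup X'] [InnerProductSpace ℂ X'] [NormedAddCommGroup Y]
    [InnerProductSpace ℂ Y] [NormedAddCommGroup Y'] [InnerProductSpace ℂ Y']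
    (S : X →L[ℂ] X') (T : Y →L[ℂ] Y') : HTensor X Y →L[ℂ] HTensor X' Y' :=
  (TensorProduct.mapL S T).completion

/-! ### Partial isometries and sums of operators -/

/-- A partial isometry: an operator that is isometric on the orthogonal complement of its
kernel. -/
def IsPartialIsometry {X Y : Type*} [NormedAddCommGroup X] [InnerProductSpace ℂ X]
    [NormedAddCommGroup Y] [InnerProductSpace ℂ Y] (U : X →L[ℂ] Y) : Prop :=
  ∀ x ∈ (LinearMap.ker (U : X →ₗ[ℂ] Y))ᗮ, ‖U x‖ = ‖x‖

open Classical in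
/-- The sum `∑ i, T i` of a family of bounded operators in the strong operator topology
(unconditional convergence at each vector, with a bounded operator as the sum); it is `0` by
convention if the family has no such sum. -/
def strongSum {ι X Y : Type*} [NormedAddCommGroup X] [InnerProductSpace ℂ X]
    [NormedAddCommGroup Y] [InnerProductSpace ℂ Y] (T : ι → X →L[ℂ] Y) : X →L[ℂ] Y :=
  if h : ∃ S : X →L[ℂ] Y, ∀ x, HasSum (fun i => T i x) (S x) then h.choose else 0

/-! ### Block matrices -/

/-- `Mat E F` is the set of all `I × J` matrices `A = (A i j)` with `A i j ∈ B(E j, F i)`. -/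
abbrev Mat {I J : Type*} (E : J → Type*) (F : I → Type*)
    [∀ j, NormedAddCommGroup (E j)] [∀ j, InnerProductSpace ℂ (E j)]
    [∀ i, NormedAddCommGroup (F i)] [∀ i, InnerProductSpace ℂ (F i)] : Type _ :=
  ∀ (i : I) (j : J), E j →L[ℂ] F i

namespace Mat

section Basic

variable {I J M : Type*} {E : J → Type*} {F : I → Type*} {G : M → Type*}
  [∀ j, NormedAddCommGroup (E j)] [∀ j, InnerProductSpace ℂ (E j)]
  [∀ i, NormedAddCommGroup (F i)] [∀ i, InnerProductSpace ℂ (F i)]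
  [∀ m, NormedAddCommGroup (G m)] [∀ m, InnerProductSpace ℂ (G m)]

/-- The product of block matrices, `(A B) i k = ∑ j, A i j B j k` (strong operator sums). -/
def mul (A : Mat F G) (B : Mat E F) : Mat E G :=
  fun m j => strongSum fun i => A m i ∘L B i j

/-- The adjoint block matrix, `A* j i = (A i j)*`. -/
def adj [∀ j, CompleteSpace (E j)] [∀ i, CompleteSpace (F i)] (A : Mat E F) : Mat F E :=
  fun j i => ContinuousLinearMap.adjoint (A i j)

open Classical in
/-- The diagonal block matrix with the diagonal entries `d j`, and `0` off the diagonal. -/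
def diagonal (d : ∀ j, E j →L[ℂ] E j) : Mat E E :=
  fun i j => Pi.single (M := fun i => E j →L[ℂ] E i) j (d j) i

/-- The unit matrix `I_E`. -/
def unit (E : J → Type*) [∀ j, NormedAddCommGroup (E j)] [∀ j, InnerProductSpace ℂ (E j)] :
    Mat E E :=
  diagonal fun j => ContinuousLinearMap.id ℂ (E j)

/-- The main diagonal `diag(X)` of a square block matrix `X`, as a diagonal matrix, has the entries
`X j j`; `sqrtDiag X` is its square root `diag(X)^{1/2}`, the diagonal matrix with the entries
`(X j j)^{1/2}` (used where all `X j j` are positive operators). -/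
def sqrtDiag [∀ j, CompleteSpace (E j)] (X : Mat E E) : Mat E E :=
  diagonal fun j => CFC.sqrt (X j j)

open Classical in
/-- `R` is the bounded operator `⨁ j, E j → Y` on the Hilbert sum whose matrix is the row `r`. -/
def IsRowOf {Y : Type*} [NormedAddCommGroup Y] [InnerProductSpace ℂ Y]
    (r : ∀ j, E j →L[ℂ] Y) (R : lp E 2 →L[ℂ] Y) : Prop :=
  ∀ j (x : E j), R (lp.single 2 j x) = r j x

/-- `C` is the bounded operator `X → ⨁ i, F i` into the Hilbert sum whose matrix is the
column `c`. -/
def IsColumnOf {X : Type*} [NormedAddCommGroup X] [InnerProductSpace ℂ X]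
    (c : ∀ i, X →L[ℂ] F i) (C : X →L[ℂ] lp F 2) : Prop :=
  ∀ i (x : X), C x i = c i x

open Classical in
/-- `A` is the matrix of the bounded operator `T : ⨁ j, E j → ⨁ i, F i`. -/
def IsMatrixOf (A : Mat E F) (T : lp E 2 →L[ℂ] lp F 2) : Prop :=
  ∀ i j (x : E j), T (lp.single 2 j x) i = A i j x

/-- `A` is row bounded, i.e. its row norm `‖A‖_r` is finite: the rows of `A` are matrices of
bounded operators, of uniformly bounded norm. -/
def RowBounded (A : Mat E F) : Prop :=
  ∃ c : ℝ, ∀ i, ∃ R : lp E 2 →L[ℂ] F i, IsRowOf (A i) R ∧ ‖R‖ ≤ c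

/-- `A` is column bounded, i.e. its column norm `‖A‖_c` is finite: the columns of `A` are
matrices of bounded operators, of uniformly bounded norm. -/
def ColumnBounded (A : Mat E F) : Prop :=
  ∃ c : ℝ, ∀ j, ∃ C : E j →L[ℂ] lp F 2, IsColumnOf (fun i => A i j) C ∧ ‖C‖ ≤ c

/-- `A` is the matrix of a bounded operator. -/
def Bounded (A : Mat E F) : Prop :=
  ∃ T : lp E 2 →L[ℂ] lp F 2, IsMatrixOf A T

/-- `A` is the matrix of a contraction. -/
def Contraction (A : Mat E F) : Prop :=
  ∃ T : lp E 2 →L[ℂ] lp F 2, IsMatrixOf A T ∧ ‖T‖ ≤ 1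

end Basic

/-- The block Schur tensor product `A ⊠ B = (A i j ⊗ B i j)`. -/
def schurTensor {I J : Type*} {E K : J → Type*} {F L : I → Type*}
    [∀ j, NormedAddCommGroup (E j)] [∀ j, InnerProductSpace ℂ (E j)]
    [∀ j, NormedAddCommGroup (K j)] [∀ j, InnerProductSpace ℂ (K j)]
    [∀ i, NormedAddCommGroup (F i)] [∀ i, InnerProductSpace ℂ (F i)]
    [∀ i, NormedAddCommGroup (L i)] [∀ i, InnerProductSpace ℂ (L i)]
    (A : Mat E F) (B : Mat K L) :
    Mat (fun j => HTensor (E j) (K j)) (fun i => HTensor (F i) (L i)) :=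
  fun i j => tensorOp (A i j) (B i j)

end Mat

end BlockSchur

end

/-! Each row of `A` is an operator `R` with polar decomposition `R = (R R*)^{1/2} U`, and `R R*` is
the corresponding diagonal entry of `A A*`. Likewise each column of `B` is `C = U (C* C)^{1/2}`,
with `C* C` a diagonal entry of `B* B`. The partial isometries form the rows of `V` and the columns
of `W` (`Mat.RowBounded.exists_polar`, `Mat.ColumnBounded.exists_polar`). Since diagonal matrices
multiply entrywise and the tensor product is multiplicative, this already gives the factorization in
(i).

For (ii) take `S = V ⊠ W`; only contractivity of the rows and columns matters
(`Mat.contraction_schurTensor`). Write `V i j ⊗ W i j = (V i j ⊗ 1)(1 ⊗ W i j)`. The columns of `1 ⊗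
W i j` and the rows of `V i j ⊗ 1` remain contractive, because a column `c` is contractive exactly
when all finite sums `∑ (c i)* (c i)` have norm at most `1`, and tensoring with the identity
preserves this bound. An interchange of the summations over `i` and `j` then bounds the whole
matrix. -/

namespace BlockSchur

open ContinuousLinearMap UniformSpace

/-! ### Polar decomposition -/

section Polar

variable {X Y : Type*} [NormedAddCommGroup X] [InnerProductSpace ℂ X] [CompleteSpace X]
  [NormedAddCommGroup Y] [InnerProductSpace ℂ Y] {U : X →L[ℂ] Y}

namespace IsPartialIsometry

/-- Take for `z` the component of `x` orthogonal to the kernel. -/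
theorem exists_apply_eq (hU : IsPartialIsometry U) (x : X) :
    ∃ z, U z = U x ∧ ‖U z‖ = ‖z‖ ∧ ‖z‖ ≤ ‖x‖ := by
  set N := LinearMap.ker (U : X →ₗ[ℂ] Y)
  have : CompleteSpace N := U.isClosed_ker.completeSpace_coe
  refine ⟨Nᗮ.starProjection x, ?_, hU _ (Nᗮ.starProjection_apply_mem x),
    Submodule.norm_starProjection_apply_le _ x⟩
  have h0 : U (N.starProjection x) = 0 := N.starProjection_apply_mem x
  conv_rhs => rw [← N.starProjection_add_starProjection_orthogonal x]
  rw [map_add, h0, zero_add]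

theorem norm_le_one (hU : IsPartialIsometry U) : ‖U‖ ≤ 1 :=
  opNorm_le_bound _ zero_le_one fun x => by
    obtain ⟨z, hz, hUz, hzx⟩ := hU.exists_apply_eq x
    rwa [one_mul, ← hz, hUz]

end IsPartialIsometry

variable [CompleteSpace Y]

/-- If `‖P x‖ = ‖T x‖` for all `x`, then `T` factors through `P` by a partial isometry. -/
theorem exists_isPartialIsometry_comp_eq (P : X →L[ℂ] X) (T : X →L[ℂ] Y)
    (h : ∀ x, ‖P x‖ = ‖T x‖) :
    ∃ W : X →L[ℂ] Y, IsPartialIsometry W ∧ T = W ∘L P := by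
  -- The norm equality makes `P x ↦ T x` well defined and isometric on the range of `P`. It extends
  -- to the closure `N`, and `W` is this extension preceded by the projection onto `N`.
  set N : Submodule ℂ X := P.range.topologicalClosure with hN
  have hmem (x : X) : P x ∈ N := Submodule.le_topologicalClosure _ ⟨x, rfl⟩
  let e : X →ₗ[ℂ] N := (P : X →ₗ[ℂ] X).codRestrict N hmem
  have hdense : DenseRange e := by
    intro y
    rw [closure_subtype]
    have himg : (Subtype.val '' Set.range e) = (P.range : Set X) := by
      ext z
      constructor
      · rintro ⟨_, ⟨x, rfl⟩, rfl⟩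
        exact ⟨x, rfl⟩
      · rintro ⟨x, rfl⟩
        exact ⟨e x, ⟨x, rfl⟩, rfl⟩
    rw [himg]
    exact y.2
  have hle : ∃ C, ∀ x, ‖(T : X →ₗ[ℂ] Y) x‖ ≤ C * ‖e x‖ :=
    ⟨1, fun x => by rw [one_mul]; exact (h x).ge⟩
  let W₀ : N →L[ℂ] Y := (T : X →ₗ[ℂ] Y).extendOfNorm e
  have hW₀ (x : X) : W₀ (e x) = T x := LinearMap.extendOfNorm_eq hdense hle x
  have hiso (y : N) : ‖W₀ y‖ = ‖y‖ := by
    refine hdense.induction_on (p := fun y => ‖W₀ y‖ = ‖y‖) y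
      (isClosed_eq (by fun_prop) (by fun_prop)) fun x => ?_
    rw [hW₀]
    exact (h x).symm
  have : CompleteSpace N := P.range.isClosed_topologicalClosure.completeSpace_coe
  refine ⟨W₀ ∘L N.orthogonalProjectionOnto, ?_, ?_⟩
  · intro x hx
    -- `W` kills `Nᗮ`, so the orthogonal complement of its kernel lies in `Nᗮᗮ = N`, where `W` is
    -- isometric.
    have hsub : Nᗮ ≤ LinearMap.ker
        ((W₀ ∘L N.orthogonalProjectionOnto : X →L[ℂ] Y) : X →ₗ[ℂ] Y) := by
      intro z hz
      have : N.orthogonalProjectionOnto z = 0 :=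
        Submodule.orthogonalProjectionOnto_eq_zero_iff.2 hz
      simp [this]
    have hxN : x ∈ N := by
      have := Submodule.orthogonal_le hsub hx
      rwa [Submodule.orthogonal_orthogonal] at this
    have : N.orthogonalProjectionOnto x = ⟨x, hxN⟩ :=
      N.orthogonalProjectionOnto_mem_subspace_eq_self ⟨x, hxN⟩
    rw [ContinuousLinearMap.comp_apply, this, hiso]
    rfl
  · ext x
    have : N.orthogonalProjectionOnto (P x) = e x :=
      N.orthogonalProjectionOnto_mem_subspace_eq_self (e x)
    rw [ContinuousLinearMap.comp_apply, ContinuousLinearMap.comp_apply, this, hW₀]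

theorem norm_apply_eq_of_comp_self_eq {P : X →L[ℂ] X} {T : X →L[ℂ] Y} (hP : adjoint P = P)
    (h : P ∘L P = adjoint T ∘L T) (x : X) : ‖P x‖ = ‖T x‖ := by
  rw [← sq_eq_sq₀ (norm_nonneg _) (norm_nonneg _), apply_norm_sq_eq_inner_adjoint_left,
    apply_norm_sq_eq_inner_adjoint_left, hP, h]

theorem adjoint_sqrt (S : X →L[ℂ] X) : adjoint (CFC.sqrt S) = CFC.sqrt S := by
  have h : (0 : X →L[ℂ] X) ≤ CFC.sqrt S := CFC.sqrt_nonneg S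
  exact isSelfAdjoint_iff'.1 (IsSelfAdjoint.of_nonneg h)

theorem norm_sqrt_adjoint_comp_self_apply (T : X →L[ℂ] Y) (x : X) :
    ‖CFC.sqrt (adjoint T ∘L T) x‖ = ‖T x‖ := by
  have hpos : (0 : X →L[ℂ] X) ≤ adjoint T ∘L T :=
    (nonneg_iff_isPositive _).2 (isPositive_adjoint_comp_self T)
  have h := CFC.sqrt_mul_sqrt_self (adjoint T ∘L T) hpos
  exact norm_apply_eq_of_comp_self_eq (adjoint_sqrt _) h x

/-- The polar decomposition. -/
theorem exists_polar (T : X →L[ℂ] Y) :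
    ∃ W : X →L[ℂ] Y, IsPartialIsometry W ∧ T = W ∘L CFC.sqrt (adjoint T ∘L T) :=
  exists_isPartialIsometry_comp_eq _ _ (norm_sqrt_adjoint_comp_self_apply T)

theorem norm_sqrt_adjoint_comp_self (T : X →L[ℂ] Y) :
    ‖CFC.sqrt (adjoint T ∘L T)‖ ≤ ‖T‖ :=
  opNorm_le_bound _ (norm_nonneg _) fun x => by
    rw [norm_sqrt_adjoint_comp_self_apply]
    exact T.le_opNorm x

namespace IsPartialIsometry

theorem adjoint (hU : IsPartialIsometry U) : IsPartialIsometry (adjoint U) := by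
  intro y hy
  -- The complement of `ker U*` is the closure of the range of `U`, so by continuity it suffices to
  -- treat vectors `U x`.
  have hy' : y ∈ closure (Set.range U) := by
    have := (ContinuousLinearMap.adjoint U).orthogonal_ker ▸ hy
    rw [adjoint_adjoint] at this
    exact this
  refine closure_minimal (t := {y | ‖ContinuousLinearMap.adjoint U y‖ = ‖y‖}) ?_
    (isClosed_eq (by fun_prop) (by fun_prop)) hy'
  rintro _ ⟨x, rfl⟩
  obtain ⟨z, hz, hUz, -⟩ := hU.exists_apply_eq x
  change ‖ContinuousLinearMap.adjoint U (U x)‖ = ‖U x‖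
  rw [← hz]
  have hle : ‖ContinuousLinearMap.adjoint U (U z)‖ ≤ ‖U z‖ := by
    have h1 := (ContinuousLinearMap.adjoint U).le_opNorm (U z)
    have h2 : ‖ContinuousLinearMap.adjoint U‖ ≤ 1 := by
      rw [LinearIsometryEquiv.norm_map]; exact hU.norm_le_one
    nlinarith [norm_nonneg (U z)]
  refine le_antisymm hle ?_
  -- Cauchy–Schwarz for `⟪U* U z, z⟫`; as `‖z‖ = ‖U z‖`, one factor cancels.
  have h1 : ‖U z‖ ^ 2 ≤ ‖ContinuousLinearMap.adjoint U (U z)‖ * ‖z‖ := by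
    rw [apply_norm_sq_eq_inner_adjoint_left]
    exact (RCLike.re_le_norm _).trans (norm_inner_le_norm _ _)
  rw [← hUz] at h1
  rcases (norm_nonneg (U z)).eq_or_lt with h0 | h0
  · rw [← h0]; exact norm_nonneg _
  · nlinarith

end IsPartialIsometry

end Polar

/-! ### Hilbert space tensor products of operators -/

section TensorOp

variable {X X' X'' Y Y' Y'' : Type*} [NormedAddCommGroup X] [InnerProductSpace ℂ X]
  [NormedAddCommGroup X'] [InnerProductSpace ℂ X'] [NormedAddCommGroup X'']
  [InnerProductSpace ℂ X''] [NormedAddCommGroup Y] [InnerProductSpace ℂ Y]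
  [NormedAddCommGroup Y'] [InnerProductSpace ℂ Y'] [NormedAddCommGroup Y'']
  [InnerProductSpace ℂ Y'']

theorem tensorOp_coe (S : X →L[ℂ] X') (T : Y →L[ℂ] Y') (z : X ⊗[ℂ] Y) :
    tensorOp S T (z : HTensor X Y) = (TensorProduct.mapL S T z : HTensor X' Y') :=
  completion_apply_coe _ z

theorem hTensor_ext {Z : Type*} [NormedAddCommGroup Z] [InnerProductSpace ℂ Z]
    {f g : HTensor X Y →L[ℂ] Z}
    (h : ∀ z : X ⊗[ℂ] Y, f (z : HTensor X Y) = g (z : HTensor X Y)) : f = g := by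
  ext z
  induction z using Completion.induction_on with
  | hp => exact isClosed_eq f.continuous g.continuous
  | ih z => exact h z

theorem tensorOp_comp (S : X' →L[ℂ] X'') (S' : X →L[ℂ] X') (T : Y' →L[ℂ] Y'')
    (T' : Y →L[ℂ] Y') :
    tensorOp (S ∘L S') (T ∘L T') = tensorOp S T ∘L tensorOp S' T' :=
  hTensor_ext fun z => by
    rw [comp_apply, tensorOp_coe, tensorOp_coe, tensorOp_coe, TensorProduct.mapL_comp, comp_apply]

theorem tensorOp_zero_left (T : Y →L[ℂ] Y') : tensorOp (0 : X →L[ℂ] X') T = 0 :=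
  hTensor_ext fun z => by
    rw [tensorOp_coe, TensorProduct.mapL_zero_left, zero_apply, zero_apply, Completion.coe_zero]

theorem tensorOp_zero_right (S : X →L[ℂ] X') : tensorOp S (0 : Y →L[ℂ] Y') = 0 :=
  hTensor_ext fun z => by
    rw [tensorOp_coe, TensorProduct.mapL_zero_right, zero_apply, zero_apply, Completion.coe_zero]

theorem tensorOp_add_left (S S' : X →L[ℂ] X') (T : Y →L[ℂ] Y') :
    tensorOp (S + S') T = tensorOp S T + tensorOp S' T :=
  hTensor_ext fun z => by
    rw [add_apply, tensorOp_coe, tensorOp_coe, tensorOp_coe, TensorProduct.mapL_add_left,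
      add_apply, Completion.coe_add]

theorem tensorOp_add_right (S : X →L[ℂ] X') (T T' : Y →L[ℂ] Y') :
    tensorOp S (T + T') = tensorOp S T + tensorOp S T' :=
  hTensor_ext fun z => by
    rw [add_apply, tensorOp_coe, tensorOp_coe, tensorOp_coe, TensorProduct.mapL_add_right,
      add_apply, Completion.coe_add]

theorem tensorOp_sum_left {ι : Type*} (s : Finset ι) (S : ι → X →L[ℂ] X') (T : Y →L[ℂ] Y') :
    tensorOp (∑ i ∈ s, S i) T = ∑ i ∈ s, tensorOp (S i) T :=
  map_sum (⟨⟨fun S => tensorOp S T, tensorOp_zero_left T⟩,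
    fun S S' => tensorOp_add_left S S' T⟩ : (X →L[ℂ] X') →+ _) S s

theorem tensorOp_sum_right {ι : Type*} (s : Finset ι) (S : X →L[ℂ] X') (T : ι → Y →L[ℂ] Y') :
    tensorOp S (∑ i ∈ s, T i) = ∑ i ∈ s, tensorOp S (T i) :=
  map_sum (⟨⟨fun T => tensorOp S T, tensorOp_zero_right S⟩,
    fun T T' => tensorOp_add_right S T T'⟩ : (Y →L[ℂ] Y') →+ _) T s

theorem norm_tensorOp_le (S : X →L[ℂ] X') (T : Y →L[ℂ] Y') : ‖tensorOp S T‖ ≤ ‖S‖ * ‖T‖ := by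
  refine opNorm_le_bound _ (by positivity) fun z => ?_
  induction z using Completion.induction_on with
  | hp => exact isClosed_le (by fun_prop) (by fun_prop)
  | ih z =>
    rw [tensorOp_coe, Completion.norm_coe, Completion.norm_coe]
    exact le_of_opNorm_le _ (TensorProduct.norm_mapL_le S T) z

theorem inner_mapL_left [CompleteSpace X] [CompleteSpace X'] [CompleteSpace Y] [CompleteSpace Y']
    (S : X →L[ℂ] X') (T : Y →L[ℂ] Y') (z : X ⊗[ℂ] Y) (w : X' ⊗[ℂ] Y') :
    inner ℂ (TensorProduct.mapL S T z) w =
      inner ℂ z (TensorProduct.mapL (adjoint S) (adjoint T) w) := by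
  induction z using TensorProduct.induction_on with
  | zero => rw [map_zero, inner_zero_left, inner_zero_left]
  | add z z' h h' => rw [map_add, inner_add_left, inner_add_left, h, h']
  | tmul x y =>
    induction w using TensorProduct.induction_on with
    | zero => rw [map_zero, inner_zero_right, inner_zero_right]
    | add w w' h h' => rw [map_add, inner_add_right, inner_add_right, h, h']
    | tmul x' y' =>
      rw [TensorProduct.mapL_tmul, TensorProduct.mapL_tmul, TensorProduct.inner_tmul,
        TensorProduct.inner_tmul, adjoint_inner_right, adjoint_inner_right]

theorem adjoint_tensorOp [CompleteSpace X] [CompleteSpace X'] [CompleteSpace Y]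
    [CompleteSpace Y'] (S : X →L[ℂ] X') (T : Y →L[ℂ] Y') :
    adjoint (tensorOp S T) = tensorOp (adjoint S) (adjoint T) := by
  symm
  rw [eq_adjoint_iff]
  intro w z
  induction z using Completion.induction_on with
  | hp => exact isClosed_eq (by fun_prop) (by fun_prop)
  | ih z =>
    induction w using Completion.induction_on with
    | hp => exact isClosed_eq (by fun_prop) (by fun_prop)
    | ih w =>
      rw [tensorOp_coe, tensorOp_coe, Completion.inner_coe, Completion.inner_coe,
        inner_mapL_left, adjoint_adjoint, adjoint_adjoint]

end TensorOp

/-! ### Families with contractive columns -/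

section Columns

variable {ι X : Type*} {G : ι → Type*} [NormedAddCommGroup X] [InnerProductSpace ℂ X]
  [∀ i, NormedAddCommGroup (G i)]

theorem hasSum_norm_sq (x : lp G 2) : HasSum (fun i => ‖x i‖ ^ 2) (‖x‖ ^ 2) := by
  have := lp.hasSum_norm (p := 2) (by norm_num) x
  simpa using this

theorem sum_norm_sq_le (x : lp G 2) (s : Finset ι) : ∑ i ∈ s, ‖x i‖ ^ 2 ≤ ‖x‖ ^ 2 :=
  sum_le_hasSum s (fun _ _ => sq_nonneg _) (hasSum_norm_sq x)

variable [∀ i, InnerProductSpace ℂ (G i)]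

theorem exists_isColumnOf {c : ∀ i, X →L[ℂ] G i} {M : ℝ} (hM : 0 ≤ M)
    (h : ∀ x (s : Finset ι), ∑ i ∈ s, ‖c i x‖ ^ 2 ≤ (M * ‖x‖) ^ 2) :
    ∃ C : X →L[ℂ] lp G 2, Mat.IsColumnOf c C ∧ ‖C‖ ≤ M := by
  have hmem (x : X) : Memℓp (fun i => c i x) 2 :=
    memℓp_gen' (C := (M * ‖x‖) ^ 2) fun s => by simpa using h x s
  let C₀ : X →ₗ[ℂ] lp G 2 :=
    { toFun := fun x => ⟨fun i => c i x, hmem x⟩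
      map_add' := fun x y => lp.ext (funext fun i => map_add (c i) x y)
      map_smul' := fun a x => lp.ext (funext fun i => map_smul (c i) a x) }
  have hC₀ (x : X) : ‖C₀ x‖ ≤ M * ‖x‖ :=
    lp.norm_le_of_forall_sum_le (p := 2) (by norm_num) (by positivity) fun s => by
      simpa [C₀] using h x s
  exact ⟨C₀.mkContinuous M hC₀, fun i x => rfl, LinearMap.mkContinuous_norm_le _ hM _⟩

theorem sum_norm_sq_le_of_isColumnOf {c : ∀ i, X →L[ℂ] G i} {C : X →L[ℂ] lp G 2}
    (hC : Mat.IsColumnOf c C) (hC1 : ‖C‖ ≤ 1) (x : X) (s : Finset ι) :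
    ∑ i ∈ s, ‖c i x‖ ^ 2 ≤ ‖x‖ ^ 2 := by
  simp only [← hC _ x]
  refine (sum_norm_sq_le (C x) s).trans ?_
  gcongr
  simpa using le_of_opNorm_le C hC1 x

variable [CompleteSpace X] [∀ i, CompleteSpace (G i)]

theorem inner_sum_adjoint_comp_self (c : ∀ i, X →L[ℂ] G i) (s : Finset ι) (x y : X) :
    inner ℂ ((∑ i ∈ s, adjoint (c i) ∘L c i) x) y = ∑ i ∈ s, inner ℂ (c i x) (c i y) := by
  rw [sum_apply, sum_inner]
  refine Finset.sum_congr rfl fun i _ => ?_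
  rw [comp_apply, adjoint_inner_left]

/-- Turns the vector inequality into an operator norm bound, which survives tensoring with an
identity; the next lemma turns it back. -/
theorem norm_sum_adjoint_comp_self_le {c : ∀ i, X →L[ℂ] G i} {s : Finset ι}
    (h : ∀ x, ∑ i ∈ s, ‖c i x‖ ^ 2 ≤ ‖x‖ ^ 2) : ‖∑ i ∈ s, adjoint (c i) ∘L c i‖ ≤ 1 := by
  set T := ∑ i ∈ s, adjoint (c i) ∘L c i with hT
  refine opNorm_le_bound _ zero_le_one fun x => ?_
  have h1 : ‖T x‖ ^ 2 ≤ ‖x‖ * ‖T x‖ := by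
    calc ‖T x‖ ^ 2 = RCLike.re (inner ℂ (T x) (T x)) := norm_sq_eq_re_inner _
      _ ≤ ‖∑ i ∈ s, inner ℂ (c i x) (c i (T x))‖ := by
        rw [hT, inner_sum_adjoint_comp_self]; exact RCLike.re_le_norm _
      _ ≤ ∑ i ∈ s, ‖c i x‖ * ‖c i (T x)‖ :=
        (norm_sum_le _ _).trans (Finset.sum_le_sum fun i _ => norm_inner_le_norm _ _)
      _ ≤ √(∑ i ∈ s, ‖c i x‖ ^ 2) * √(∑ i ∈ s, ‖c i (T x)‖ ^ 2) :=
        Real.sum_mul_le_sqrt_mul_sqrt _ _ _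
      _ ≤ ‖x‖ * ‖T x‖ := by
        gcongr <;> exact Real.sqrt_le_left (norm_nonneg _) |>.2 (h _)
  rcases (norm_nonneg (T x)).eq_or_lt with h0 | h0
  · rw [← h0]; positivity
  · nlinarith

theorem sum_norm_sq_le_of_norm_sum_adjoint_comp_self_le {c : ∀ i, X →L[ℂ] G i} {s : Finset ι}
    (h : ‖∑ i ∈ s, adjoint (c i) ∘L c i‖ ≤ 1) (x : X) : ∑ i ∈ s, ‖c i x‖ ^ 2 ≤ ‖x‖ ^ 2 := by
  have h1 : ∑ i ∈ s, ‖c i x‖ ^ 2 =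
      RCLike.re (inner ℂ ((∑ i ∈ s, adjoint (c i) ∘L c i) x) x) := by
    rw [inner_sum_adjoint_comp_self, map_sum]
    exact Finset.sum_congr rfl fun i _ => norm_sq_eq_re_inner _
  rw [h1]
  calc _ ≤ ‖(∑ i ∈ s, adjoint (c i) ∘L c i) x‖ * ‖x‖ :=
        (RCLike.re_le_norm _).trans (norm_inner_le_norm _ _)
    _ ≤ ‖x‖ * ‖x‖ := by gcongr; simpa using le_of_opNorm_le _ h x
    _ = ‖x‖ ^ 2 := by ring

variable {Y : Type*} [NormedAddCommGroup Y] [InnerProductSpace ℂ Y] [CompleteSpace Y]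

theorem sum_norm_sq_tensorOp_id_left_le {c : ∀ i, X →L[ℂ] G i} {s : Finset ι}
    (h : ∀ x, ∑ i ∈ s, ‖c i x‖ ^ 2 ≤ ‖x‖ ^ 2) (z : HTensor Y X) :
    ∑ i ∈ s, ‖tensorOp (ContinuousLinearMap.id ℂ Y) (c i) z‖ ^ 2 ≤ ‖z‖ ^ 2 := by
  refine sum_norm_sq_le_of_norm_sum_adjoint_comp_self_le ?_ z
  -- `∑ (1 ⊗ c i)* (1 ⊗ c i) = 1 ⊗ ∑ (c i)* (c i)`.
  simp only [adjoint_tensorOp, ← tensorOp_comp, adjoint_id, comp_id, ← tensorOp_sum_right]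
  exact (norm_tensorOp_le _ _).trans
    (mul_le_one₀ norm_id_le (norm_nonneg _) (norm_sum_adjoint_comp_self_le h))

theorem sum_norm_sq_tensorOp_id_right_le {c : ∀ i, X →L[ℂ] G i} {s : Finset ι}
    (h : ∀ x, ∑ i ∈ s, ‖c i x‖ ^ 2 ≤ ‖x‖ ^ 2) (z : HTensor X Y) :
    ∑ i ∈ s, ‖tensorOp (c i) (ContinuousLinearMap.id ℂ Y) z‖ ^ 2 ≤ ‖z‖ ^ 2 := by
  refine sum_norm_sq_le_of_norm_sum_adjoint_comp_self_le ?_ z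
  simp only [adjoint_tensorOp, ← tensorOp_comp, adjoint_id, comp_id, ← tensorOp_sum_left]
  exact (norm_tensorOp_le _ _).trans
    (mul_le_one₀ (norm_sum_adjoint_comp_self_le h) (norm_nonneg _) norm_id_le)

end Columns

/-! ### Rows, columns and matrices of bounded operators -/

section Rows

variable {ι Y : Type*} {G : ι → Type*} [NormedAddCommGroup Y] [InnerProductSpace ℂ Y]
  [∀ i, NormedAddCommGroup (G i)] [∀ i, InnerProductSpace ℂ (G i)]

/-- Supplies the strong convergence that identifies the diagonal entries of `A A*` and `B* B`, so
the default value of `strongSum` does not occur there. -/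
theorem Mat.IsRowOf.hasSum {r : ∀ i, G i →L[ℂ] Y} {R : lp G 2 →L[ℂ] Y} (hR : Mat.IsRowOf r R)
    (x : lp G 2) : HasSum (fun i => r i (x i)) (R x) := by
  classical
  have h := (lp.hasSum_single (by norm_num) x).mapL R
  convert! h using 2 with i
  rw [← hR i (x i)]

variable [CompleteSpace Y] [∀ i, CompleteSpace (G i)]

theorem Mat.IsRowOf.adjoint {r : ∀ i, G i →L[ℂ] Y} {R : lp G 2 →L[ℂ] Y}
    (hR : Mat.IsRowOf r R) :
    Mat.IsColumnOf (fun i => ContinuousLinearMap.adjoint (r i))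
      (ContinuousLinearMap.adjoint R) := by
  classical
  intro i y
  refine ext_inner_left ℂ fun x => ?_
  rw [adjoint_inner_right, ← lp.inner_single_left (𝕜 := ℂ) i x, adjoint_inner_right, ← hR i x]

theorem Mat.IsColumnOf.adjoint {c : ∀ i, Y →L[ℂ] G i} {C : Y →L[ℂ] lp G 2}
    (hC : Mat.IsColumnOf c C) :
    Mat.IsRowOf (fun i => ContinuousLinearMap.adjoint (c i))
      (ContinuousLinearMap.adjoint C) := by
  classical
  intro i x
  refine ext_inner_right ℂ fun y => ?_
  rw [adjoint_inner_left, adjoint_inner_left, ← hC i y]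
  exact lp.inner_single_left i x (C y)

/-- Tensoring a contractive row with an identity operator gives a contractive row. -/
theorem Mat.IsRowOf.exists_isRowOf_tensorOp {r : ∀ i, G i →L[ℂ] Y} {R : lp G 2 →L[ℂ] Y}
    (hR : Mat.IsRowOf r R) (hR1 : ‖R‖ ≤ 1) (Z : Type*) [NormedAddCommGroup Z]
    [InnerProductSpace ℂ Z] [CompleteSpace Z] :
    ∃ R' : lp (fun i => HTensor (G i) Z) 2 →L[ℂ] HTensor Y Z,
      Mat.IsRowOf (fun i => tensorOp (r i) (ContinuousLinearMap.id ℂ Z)) R' ∧ ‖R'‖ ≤ 1 := by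
  have hadj : ‖ContinuousLinearMap.adjoint R‖ ≤ 1 := by rwa [LinearIsometryEquiv.norm_map]
  obtain ⟨C, hC, hC1⟩ := exists_isColumnOf
    (c := fun i => tensorOp (ContinuousLinearMap.adjoint (r i)) (ContinuousLinearMap.id ℂ Z))
    zero_le_one fun z s => by
      rw [one_mul]
      exact sum_norm_sq_tensorOp_id_right_le
        (fun x => sum_norm_sq_le_of_isColumnOf hR.adjoint hadj x s) z
  refine ⟨ContinuousLinearMap.adjoint C, ?_, by rwa [LinearIsometryEquiv.norm_map]⟩
  have := hC.adjoint
  simpa only [adjoint_tensorOp, adjoint_adjoint, adjoint_id] using this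

end Rows

/-! ### Strong sums and products with diagonal matrices -/

section StrongSum

variable {ι X Y : Type*} [NormedAddCommGroup X] [InnerProductSpace ℂ X]
  [NormedAddCommGroup Y] [InnerProductSpace ℂ Y]

theorem strongSum_eq {T : ι → X →L[ℂ] Y} {S : X →L[ℂ] Y}
    (h : ∀ x, HasSum (fun i => T i x) (S x)) : strongSum T = S := by
  have hex : ∃ S : X →L[ℂ] Y, ∀ x, HasSum (fun i => T i x) (S x) := ⟨S, h⟩
  rw [strongSum, dif_pos hex]
  ext x
  exact (hex.choose_spec x).unique (h x)

theorem strongSum_eq_single {T : ι → X →L[ℂ] Y} (i : ι) (h : ∀ k, k ≠ i → T k = 0) :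
    strongSum T = T i :=
  strongSum_eq fun x => hasSum_single i fun k hk => by rw [h k hk, zero_apply]

end StrongSum

namespace Mat

section Diagonal

variable {I J : Type*} {E K : J → Type*} {F L : I → Type*}
  [∀ j, NormedAddCommGroup (E j)] [∀ j, InnerProductSpace ℂ (E j)]
  [∀ j, NormedAddCommGroup (K j)] [∀ j, InnerProductSpace ℂ (K j)]
  [∀ i, NormedAddCommGroup (F i)] [∀ i, InnerProductSpace ℂ (F i)]

theorem diagonal_self (d : ∀ j, E j →L[ℂ] E j) (j : J) : diagonal d j j = d j := by
  classical
  simp only [diagonal]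
  exact Pi.single_eq_same (M := fun i => E j →L[ℂ] E i) j (d j)

theorem diagonal_of_ne (d : ∀ j, E j →L[ℂ] E j) {i j : J} (h : i ≠ j) : diagonal d i j = 0 := by
  classical
  simp only [diagonal]
  exact Pi.single_eq_of_ne (M := fun i => E j →L[ℂ] E i) h (d j)

theorem diagonal_schurTensor_diagonal (d : ∀ j, E j →L[ℂ] E j) (d' : ∀ j, K j →L[ℂ] K j) :
    (diagonal d).schurTensor (diagonal d') = diagonal fun j => tensorOp (d j) (d' j) := by
  funext i j
  rcases eq_or_ne i j with rfl | h
  · simp only [schurTensor, diagonal_self]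
  · simp only [schurTensor, diagonal_of_ne _ h, tensorOp_zero_left]

theorem diagonal_mul (d : ∀ i, F i →L[ℂ] F i) (X : Mat E F) (i : I) (j : J) :
    (diagonal d).mul X i j = d i ∘L X i j := by
  rw [mul, strongSum_eq_single i, diagonal_self]
  intro k hk
  rw [diagonal_of_ne _ hk.symm, zero_comp]

theorem mul_diagonal (X : Mat E F) (d : ∀ j, E j →L[ℂ] E j) (i : I) (j : J) :
    X.mul (diagonal d) i j = X i j ∘L d j := by
  rw [mul, strongSum_eq_single j, diagonal_self]
  intro k hk
  rw [diagonal_of_ne _ hk, comp_zero]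

theorem bounded_diagonal {d : ∀ j, E j →L[ℂ] E j} {M : ℝ} (hM : ∀ j, ‖d j‖ ≤ M) :
    (diagonal d).Bounded := by
  classical
  have hd (j : J) (y : E j) : ‖d j y‖ ^ 2 ≤ |M| ^ 2 * ‖y‖ ^ 2 := by
    rw [← mul_pow]
    gcongr
    exact le_of_opNorm_le _ ((hM j).trans (le_abs_self M)) y
  -- The bound is `|M|` because `M` may be negative when `J` is empty.
  obtain ⟨T, hT, -⟩ := exists_isColumnOf (X := lp E 2)
    (c := fun j => d j ∘L lp.evalCLM ℂ E 2 j) (abs_nonneg M) fun x s => by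
      refine (Finset.sum_le_sum fun j _ => hd j (x j)).trans ?_
      rw [← Finset.mul_sum, mul_pow]
      gcongr
      exact sum_norm_sq_le x s
  refine ⟨T, fun i j x => ?_⟩
  rw [hT i]
  rcases eq_or_ne i j with rfl | h
  · rw [diagonal_self]
    exact congrArg (d i) (lp.single_apply_self 2 i x)
  · rw [diagonal_of_ne _ h]
    exact (congrArg (d i) (lp.single_apply_ne 2 j x h)).trans (map_zero _)

end Diagonal

/-! ### Contractive Schur tensor products, and polar decompositions of rows and columns. -/

section Contraction

variable {I J : Type*} {E K : J → Type*} {F L : I → Type*}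
  [∀ j, NormedAddCommGroup (E j)] [∀ j, InnerProductSpace ℂ (E j)] [∀ j, CompleteSpace (E j)]
  [∀ j, NormedAddCommGroup (K j)] [∀ j, InnerProductSpace ℂ (K j)] [∀ j, CompleteSpace (K j)]
  [∀ i, NormedAddCommGroup (F i)] [∀ i, InnerProductSpace ℂ (F i)] [∀ i, CompleteSpace (F i)]
  [∀ i, NormedAddCommGroup (L i)] [∀ i, InnerProductSpace ℂ (L i)] [∀ i, CompleteSpace (L i)]

/-- The block Schur tensor product of a matrix with contractive rows and a matrix with contractive
columns is the matrix of a contraction. -/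
theorem contraction_schurTensor {V : Mat E F} {W : Mat K L}
    (hV : ∀ i, ∃ R : lp E 2 →L[ℂ] F i, IsRowOf (V i) R ∧ ‖R‖ ≤ 1)
    (hW : ∀ j, ∃ C : K j →L[ℂ] lp L 2, IsColumnOf (fun i => W i j) C ∧ ‖C‖ ≤ 1) :
    (V.schurTensor W).Contraction := by
  have hcol (j : J) (z : HTensor (E j) (K j)) (s : Finset I) :
      ∑ i ∈ s, ‖tensorOp (ContinuousLinearMap.id ℂ (E j)) (W i j) z‖ ^ 2 ≤ ‖z‖ ^ 2 := by
    obtain ⟨C, hC, hC1⟩ := hW j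
    exact sum_norm_sq_tensorOp_id_left_le (c := fun i => W i j)
      (fun x => sum_norm_sq_le_of_isColumnOf hC hC1 x s) z
  choose R hR hR1 using fun i => (hV i).elim fun R hR =>
    hR.1.exists_isRowOf_tensorOp hR.2 (L i)
  -- For fixed `i`, `Z i` applies `1 ⊗ W i j` in each coordinate `j`. The contraction sought has the
  -- components `R i ∘L Z i`.
  have hZ (i : I) := exists_isColumnOf (X := lp (fun j => HTensor (E j) (K j)) 2)
    (c := fun j => tensorOp (ContinuousLinearMap.id ℂ (E j)) (W i j) ∘L
      lp.evalCLM ℂ (fun j => HTensor (E j) (K j)) 2 j) zero_le_one fun x s => by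
      rw [one_mul]
      refine le_trans (Finset.sum_le_sum fun j _ => ?_) (sum_norm_sq_le x s)
      have h := hcol j (x j) {i}
      rwa [Finset.sum_singleton] at h
  choose Z hZc _ using hZ
  have hRZ (x : lp (fun j => HTensor (E j) (K j)) 2) (s : Finset I) :
      ∑ i ∈ s, ‖R i (Z i x)‖ ^ 2 ≤ ‖x‖ ^ 2 := by
    calc ∑ i ∈ s, ‖R i (Z i x)‖ ^ 2 ≤ ∑ i ∈ s, ‖Z i x‖ ^ 2 := by
          gcongr with i
          simpa using le_of_opNorm_le _ (hR1 i) (Z i x)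
      _ ≤ ‖x‖ ^ 2 := by
          -- Summing over `i` first, the bound for column `j` of `W` applies to each `x j`.
          refine hasSum_le (fun j => ?_) (hasSum_sum fun i _ => hasSum_norm_sq (Z i x))
            (hasSum_norm_sq x)
          simp only [hZc _ j]
          exact hcol j (x j) s
  obtain ⟨T, hT, hT1⟩ := exists_isColumnOf (c := fun i => R i ∘L Z i) zero_le_one fun x s => by
    rw [one_mul]
    exact hRZ x s
  refine ⟨T, fun i j x => ?_, hT1⟩
  classical
  have hZs : Z i (lp.single 2 j x) =
      lp.single 2 j (tensorOp (ContinuousLinearMap.id ℂ (E j)) (W i j) x) := by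
    refine lp.ext (funext fun k => ?_)
    rw [hZc i k]
    rcases eq_or_ne k j with rfl | h
    · rw [lp.single_apply_self]
      exact congrArg (tensorOp (ContinuousLinearMap.id ℂ (E k)) (W i k))
        (lp.single_apply_self (E := fun j => HTensor (E j) (K j)) 2 k x)
    · rw [lp.single_apply_ne _ _ _ h]
      exact (congrArg (tensorOp (ContinuousLinearMap.id ℂ (E k)) (W i k))
        (lp.single_apply_ne (E := fun j => HTensor (E j) (K j)) 2 j x h)).trans (map_zero _)
  have h1 : T (lp.single 2 j x) i = R i (Z i (lp.single 2 j x)) := hT i _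
  have h2 : R i (lp.single 2 j (tensorOp (ContinuousLinearMap.id ℂ (E j)) (W i j) x)) =
      tensorOp (V i j) (ContinuousLinearMap.id ℂ (L i))
        (tensorOp (ContinuousLinearMap.id ℂ (E j)) (W i j) x) := by
    rw [← hR i j]
  have h3 : V.schurTensor W i j = tensorOp (V i j) (ContinuousLinearMap.id ℂ (L i)) ∘L
      tensorOp (ContinuousLinearMap.id ℂ (E j)) (W i j) := by
    rw [← tensorOp_comp, comp_id, id_comp, schurTensor]
  rw [h3, comp_apply, ← h2, ← hZs, ← h1]

/-- The diagonal entries of `A A*`. -/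
theorem IsRowOf.mul_adj_apply {A : Mat E F} {i : I} {R : lp E 2 →L[ℂ] F i}
    (hR : IsRowOf (A i) R) : A.mul A.adj i i = R ∘L ContinuousLinearMap.adjoint R :=
  strongSum_eq fun x => by
    have := hR.hasSum (ContinuousLinearMap.adjoint R x)
    simp only [hR.adjoint _ x] at this
    exact this

/-- The diagonal entries of `B* B`. -/
theorem IsColumnOf.adj_mul_apply {B : Mat K L} {j : J} {C : K j →L[ℂ] lp L 2}
    (hC : IsColumnOf (fun i => B i j) C) :
    B.adj.mul B j j = ContinuousLinearMap.adjoint C ∘L C :=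
  strongSum_eq fun x => by
    have := hC.adjoint.hasSum (C x)
    simp only [hC _ x] at this
    exact this

/-- The rows of `A` have polar decompositions with the moduli `diag(A A*)^{1/2}`. -/
theorem IsRowOf.exists_polar {A : Mat E F} {i : I} {R : lp E 2 →L[ℂ] F i}
    (hR : IsRowOf (A i) R) :
    ∃ U : lp E 2 →L[ℂ] F i, IsPartialIsometry U ∧ R = CFC.sqrt (A.mul A.adj i i) ∘L U := by
  obtain ⟨W, hW, hRW⟩ := BlockSchur.exists_polar (ContinuousLinearMap.adjoint R)
  refine ⟨ContinuousLinearMap.adjoint W, hW.adjoint, ?_⟩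
  -- Taking adjoints in `R* = W (R R*)^{1/2}` moves the modulus to the left.
  have := congrArg ContinuousLinearMap.adjoint hRW
  rw [adjoint_comp, adjoint_sqrt, adjoint_adjoint, ← hR.mul_adj_apply] at this
  exact this

theorem RowBounded.exists_norm_sqrt_le {A : Mat E F} (hA : A.RowBounded) :
    ∃ c : ℝ, ∀ i, ‖CFC.sqrt (A.mul A.adj i i)‖ ≤ c := by
  obtain ⟨c, hc⟩ := hA
  refine ⟨c, fun i => ?_⟩
  obtain ⟨R, hR, hRc⟩ := hc i
  have := norm_sqrt_adjoint_comp_self (ContinuousLinearMap.adjoint R)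
  rw [adjoint_adjoint, ← hR.mul_adj_apply, LinearIsometryEquiv.norm_map] at this
  exact this.trans hRc

theorem ColumnBounded.exists_norm_sqrt_le {B : Mat K L} (hB : B.ColumnBounded) :
    ∃ c : ℝ, ∀ j, ‖CFC.sqrt (B.adj.mul B j j)‖ ≤ c := by
  obtain ⟨c, hc⟩ := hB
  refine ⟨c, fun j => ?_⟩
  obtain ⟨C, hC, hCc⟩ := hc j
  rw [hC.adj_mul_apply]
  exact (norm_sqrt_adjoint_comp_self C).trans hCc

/-- There is a matrix `V` whose rows are partial isometries with `A = diag(A A*)^{1/2} V`. -/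
theorem RowBounded.exists_polar {A : Mat E F} (hA : A.RowBounded) :
    ∃ V : Mat E F, (∀ i, ∃ R : lp E 2 →L[ℂ] F i, IsRowOf (V i) R ∧ IsPartialIsometry R) ∧
      ∀ i j, A i j = CFC.sqrt (A.mul A.adj i i) ∘L V i j := by
  classical
  obtain ⟨c, hc⟩ := hA
  choose R hR _ using hc
  choose U hU hRU using fun i => (hR i).exists_polar
  refine ⟨fun i j => U i ∘L lp.singleContinuousLinearMap ℂ E 2 j,
    fun i => ⟨U i, fun j x => ?_, hU i⟩, fun i j => ?_⟩
  · rw [comp_apply, lp.singleContinuousLinearMap_apply]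
  · ext x
    rw [← hR i j x, ← comp_assoc, ← hRU i, comp_apply, lp.singleContinuousLinearMap_apply]

/-- There is a matrix `W` whose columns are partial isometries with `B = W diag(B* B)^{1/2}`. -/
theorem ColumnBounded.exists_polar {B : Mat K L} (hB : B.ColumnBounded) :
    ∃ W : Mat K L,
      (∀ j, ∃ C : K j →L[ℂ] lp L 2, IsColumnOf (fun i => W i j) C ∧ IsPartialIsometry C) ∧
      ∀ i j, B i j = W i j ∘L CFC.sqrt (B.adj.mul B j j) := by
  obtain ⟨c, hc⟩ := hB
  choose C hC _ using hc
  choose U hU hCU using fun j => BlockSchur.exists_polar (C j)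
  refine ⟨fun i j => lp.evalCLM ℂ L 2 i ∘L U j, fun j => ⟨U j, fun i x => rfl, hU j⟩,
    fun i j => ?_⟩
  rw [comp_assoc, (hC j).adj_mul_apply, ← hCU j]
  ext x
  exact (hC j i x).symm

end Contraction

end Mat

end BlockSchur

/-! ### The factorization theorem. -/

theorem theorem5p2 {I J : Type*} (E K : J → Type*) (F L : I → Type*)
    [∀ j, NormedAddCommGroup (E j)] [∀ j, InnerProductSpace ℂ (E j)] [∀ j, CompleteSpace (E j)]
    [∀ j, NormedAddCommGroup (K j)] [∀ j, InnerProductSpace ℂ (K j)] [∀ j, CompleteSpace (K j)]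
    [∀ i, NormedAddCommGroup (F i)] [∀ i, InnerProductSpace ℂ (F i)] [∀ i, CompleteSpace (F i)]
    [∀ i, NormedAddCommGroup (L i)] [∀ i, InnerProductSpace ℂ (L i)] [∀ i, CompleteSpace (L i)]
    (A : BlockSchur.Mat E F) (B : BlockSchur.Mat K L)
    (hA : A.RowBounded) (hB : B.ColumnBounded) :
    (∃ (V : BlockSchur.Mat E F) (W : BlockSchur.Mat K L),
      (∀ i, ∃ R : lp E 2 →L[ℂ] F i,
        BlockSchur.Mat.IsRowOf (V i) R ∧ BlockSchur.IsPartialIsometry R) ∧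
      (∀ j, ∃ C : K j →L[ℂ] lp L 2,
        BlockSchur.Mat.IsColumnOf (fun i => W i j) C ∧ BlockSchur.IsPartialIsometry C) ∧
      A.schurTensor B =
        (((A.mul A.adj).sqrtDiag.schurTensor (BlockSchur.Mat.unit L)).mul (V.schurTensor W)).mul
          ((BlockSchur.Mat.unit E).schurTensor (B.adj.mul B).sqrtDiag)) ∧
    ((A.mul A.adj).sqrtDiag.schurTensor (BlockSchur.Mat.unit L)).Bounded ∧
    ((BlockSchur.Mat.unit E).schurTensor (B.adj.mul B).sqrtDiag).Bounded ∧
    (∃ S : BlockSchur.Mat (fun j => BlockSchur.HTensor (E j) (K j))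
        (fun i => BlockSchur.HTensor (F i) (L i)),
      S.Contraction ∧
      A.schurTensor B =
        (((A.mul A.adj).sqrtDiag.schurTensor (BlockSchur.Mat.unit L)).mul S).mul
          ((BlockSchur.Mat.unit E).schurTensor (B.adj.mul B).sqrtDiag)) := by
  obtain ⟨V, hV, hAV⟩ := hA.exists_polar
  obtain ⟨W, hW, hBW⟩ := hB.exists_polar
  obtain ⟨a, ha⟩ := hA.exists_norm_sqrt_le
  obtain ⟨b, hb⟩ := hB.exists_norm_sqrt_le
  have hfactor : A.schurTensor B =
      (((A.mul A.adj).sqrtDiag.schurTensor (BlockSchur.Mat.unit L)).mul (V.schurTensor W)).mul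
        ((BlockSchur.Mat.unit E).schurTensor (B.adj.mul B).sqrtDiag) := by
    funext i j
    rw [BlockSchur.Mat.sqrtDiag, BlockSchur.Mat.sqrtDiag, BlockSchur.Mat.unit,
      BlockSchur.Mat.unit, BlockSchur.Mat.diagonal_schurTensor_diagonal,
      BlockSchur.Mat.diagonal_schurTensor_diagonal, BlockSchur.Mat.mul_diagonal,
      BlockSchur.Mat.diagonal_mul, BlockSchur.Mat.schurTensor, BlockSchur.Mat.schurTensor,
      ← BlockSchur.tensorOp_comp, ← BlockSchur.tensorOp_comp, ContinuousLinearMap.id_comp,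
      ContinuousLinearMap.comp_id, ← hAV, ← hBW]
  refine ⟨⟨V, W, hV, hW, hfactor⟩, ?_, ?_, V.schurTensor W, ?_, hfactor⟩
  · rw [BlockSchur.Mat.sqrtDiag, BlockSchur.Mat.unit,
      BlockSchur.Mat.diagonal_schurTensor_diagonal]
    refine BlockSchur.Mat.bounded_diagonal (M := a) fun i => ?_
    calc _ ≤ ‖CFC.sqrt (A.mul A.adj i i)‖ * ‖ContinuousLinearMap.id ℂ (L i)‖ :=
          BlockSchur.norm_tensorOp_le _ _
      _ ≤ ‖CFC.sqrt (A.mul A.adj i i)‖ * 1 := by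
          gcongr
          exact ContinuousLinearMap.norm_id_le
      _ ≤ a := by rw [mul_one]; exact ha i
  · rw [BlockSchur.Mat.sqrtDiag, BlockSchur.Mat.unit,
      BlockSchur.Mat.diagonal_schurTensor_diagonal]
    refine BlockSchur.Mat.bounded_diagonal (M := b) fun j => ?_
    calc _ ≤ ‖ContinuousLinearMap.id ℂ (E j)‖ * ‖CFC.sqrt (B.adj.mul B j j)‖ :=
          BlockSchur.norm_tensorOp_le _ _
      _ ≤ 1 * ‖CFC.sqrt (B.adj.mul B j j)‖ := by
          gcongr
          exact ContinuousLinearMap.norm_id_le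
      _ ≤ b := by rw [one_mul]; exact hb j
  · refine BlockSchur.Mat.contraction_schurTensor (fun i => ?_) fun j => ?_
    · obtain ⟨R, hR, hR'⟩ := hV i
      exact ⟨R, hR, hR'.norm_le_one⟩
    · obtain ⟨C, hC, hC'⟩ := hW j
      exact ⟨C, hC, hC'.norm_le_one⟩
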